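/- Let $d\ge 1$ be an integer, let $\Delta f(x)=\sum_{|y-x|=1}(f(x)-f(y))$ be the discrete Laplacian, a bounded operator on $\ell^2(\mathbb{Z}^d)$, where $|\cdot|$ is the Euclidean norm, and let $e^{-t\Delta}$, $t\ge 0$, be its heat semigroup. For $-d/2<\sigma<1$, $\sigma\neq 0$, the discrete Riesz kernel $\kappa_\sigma$ on $\mathbb{Z}^d$ is defined by $\kappa_\sigma(0)=0$ if $\sigma>0$, and in all other cases by $$\kappa_\sigma(x)=\frac{1}{|\Gamma(-\sigma)|}\int_0^\infty e^{-t\Delta}1_0(x)\,\frac{dt}{t^{1+\sigma}},$$ where $1_0$ is the characteristic function of the origin. Then $\kappa_\sigma$ is finite, that is, this integral converges absolutely for all $-d/2<\sigma<1$, $\sigma\ne0$, and all $x\in\mathbb{Z}^d$, except for the excluded case $x=0$, $\sigma>0$. Moreover, as $|x|\to\infty$, $$\kappa_\sigma(x)=C_{d,\sigma}|x|^{-d-2\sigma}+O\left(|x|^{-d-2\sigma-2}\right),\qquad C_{d,\sigma}=\frac{4^\sigma\,\Gamma(d/2+\sigma)}{\pi^{d/2}\,|\Gamma(-\sigma)|},$$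 with an error that is uniform in $\sigma$: there are constants $C,R$ depending only on $d$ such that for all $\sigma\in(-d/2,1)\setminus\{0\}$ and all $x\in\mathbb{Z}^d$ with $|x|\ge R$, $$\left|\kappa_\sigma(x)-C_{d,\sigma}|x|^{-d-2\sigma}\right|\le C\,|x|^{-d-2\sigma-2}.$$ -/

import Mathlib

open MeasureTheory Set
open scoped ENNReal

noncomputable section

namespace DiscreteRiesz

/-- The Euclidean norm `|x|` of a lattice point `x ∈ ℤ^d`. -/
def latticeNorm {d : ℕ} (x : Fin d → ℤ) : ℝ :=
  ‖(WithLp.toLp 2 (fun i => (x i : ℝ)) : EuclideanSpace ℝ (Fin d))‖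

/-- The Hilbert space `ℓ²(ℤ^d)` of real square-summable functions. -/
abbrev EllTwo (d : ℕ) : Type := lp (fun _ : Fin d → ℤ => ℝ) 2

theorem summable_sq {d : ℕ} (f : EllTwo d) : Summable fun x => ‖f x‖ ^ (2 : ℝ≥0∞).toReal :=
  (lp.memℓp f).summable (by norm_num)

theorem memℓp_translate {d : ℕ} (v : Fin d → ℤ) (f : EllTwo d) :
    Memℓp (fun x : Fin d → ℤ => f (x + v)) 2 :=
  memℓp_gen ((Equiv.addRight v).summable_iff.mpr (summable_sq f))

/-- Translation `f ↦ f(· + v)` on `ℓ²(ℤ^d)`, a linear isometry. -/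
def translate {d : ℕ} (v : Fin d → ℤ) : EllTwo d →ₗᵢ[ℝ] EllTwo d where
  toFun f := ⟨fun x => f (x + v), memℓp_translate v f⟩
  map_add' _ _ := rfl
  map_smul' _ _ := rfl
  norm_map' f := by
    have h2 : 0 < (2 : ℝ≥0∞).toReal := by norm_num
    rw [lp.norm_eq_tsum_rpow h2, lp.norm_eq_tsum_rpow h2]
    congr 1
    exact (Equiv.addRight v).tsum_eq fun x => ‖f x‖ ^ (2 : ℝ≥0∞).toReal

/-- The standard unit vector `e_i ∈ ℤ^d`. -/
def unitVec {d : ℕ} (i : Fin d) : Fin d → ℤ := Pi.single i 1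

/-- The discrete Laplacian on `ℓ²(ℤ^d)` as a bounded operator,
`Δf(x) = ∑_{|y - x| = 1} (f(x) - f(y))`; the neighbours of `x` are the `2d` points `x ± e_i`
(see `laplacian_apply` and `laplacian_eq_sum_neighbours`). -/
def laplacian (d : ℕ) : EllTwo d →L[ℝ] EllTwo d :=
  ∑ i : Fin d, (2 • ContinuousLinearMap.id ℝ (EllTwo d)
    - (translate (unitVec i)).toContinuousLinearMap
    - (translate (-unitVec i)).toContinuousLinearMap)

theorem laplacian_apply {d : ℕ} (f : EllTwo d) (x : Fin d → ℤ) :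
    laplacian d f x =
      ∑ i : Fin d, ((f x - f (x + unitVec i)) + (f x - f (x - unitVec i))) := by
  simp only [laplacian, _root_.sum_apply, lp.coeFn_sum, Finset.sum_apply]
  refine Finset.sum_congr rfl fun i _ => ?_
  have h : (2 • ContinuousLinearMap.id ℝ (EllTwo d)
    - (translate (unitVec i)).toContinuousLinearMap
    - (translate (-unitVec i)).toContinuousLinearMap) f x
    = (2 • f x - f (x + unitVec i)) - f (x + -unitVec i) := rfl
  rw [h, ← sub_eq_add_neg, two_smul]
  ring

theorem latticeNorm_eq_one_iff {d : ℕ} (v : Fin d → ℤ) :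
    latticeNorm v = 1 ↔ ∃ i, v = unitVec i ∨ v = -unitVec i := by
  have key : latticeNorm v = 1 ↔ ∑ i, (v i) ^ 2 = 1 := by
    rw [latticeNorm, EuclideanSpace.norm_eq, Real.sqrt_eq_one]
    simp only [Real.norm_eq_abs, sq_abs]
    exact_mod_cast Iff.rfl
  rw [key]
  constructor
  · intro h
    have hne : ∃ i, v i ≠ 0 := by
      by_contra! h0
      simp [h0] at h
    obtain ⟨i, hi⟩ := hne
    have hi1 : 1 ≤ (v i) ^ 2 := by
      have := sq_nonneg (v i)
      have : (v i) ^ 2 ≠ 0 := pow_ne_zero 2 hi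
      lia
    rw [← Finset.add_sum_erase _ _ (Finset.mem_univ i)] at h
    have hrest : ∑ j ∈ Finset.univ.erase i, (v j) ^ 2 = 0 := by
      have : 0 ≤ ∑ j ∈ Finset.univ.erase i, (v j) ^ 2 := Finset.sum_nonneg fun j _ => sq_nonneg _
      lia
    have hz : ∀ j, j ≠ i → v j = 0 := fun j hj => by
      have := (Finset.sum_eq_zero_iff_of_nonneg fun j _ => sq_nonneg (v j)).mp hrest j
        (Finset.mem_erase.mpr ⟨hj, Finset.mem_univ j⟩)
      simpa using this
    have hvi : (v i) ^ 2 = 1 := by lia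
    refine ⟨i, ?_⟩
    rcases (show v i = 1 ∨ v i = -1 by simpa using hvi) with h1 | h1
    · left
      ext j
      by_cases hj : j = i
      · subst hj; simp [unitVec, h1]
      · simp [unitVec, hz j hj, hj]
    · right
      ext j
      by_cases hj : j = i
      · subst hj; simp [unitVec, h1]
      · simp [unitVec, hz j hj, hj]
  · rintro ⟨i, rfl | rfl⟩ <;> simp [unitVec, Pi.single_apply, ite_pow]

theorem laplacian_eq_sum_neighbours {d : ℕ} (f : EllTwo d) (x : Fin d → ℤ) :
    laplacian d f x = ∑ᶠ y ∈ {y | latticeNorm (y - x) = 1}, (f x - f y) := by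
  have hinj : Function.Injective (unitVec : Fin d → Fin d → ℤ) := by
    intro i j hij
    by_contra hne
    have := congrFun hij i
    simp [unitVec, hne] at this
  have hset : {y | latticeNorm (y - x) = 1} =
      (((Finset.univ.image fun i : Fin d => x + unitVec i) ∪
        (Finset.univ.image fun i : Fin d => x - unitVec i) : Finset (Fin d → ℤ)) :
        Set (Fin d → ℤ)) := by
    ext y
    simp only [mem_ofPred_eq, latticeNorm_eq_one_iff, Finset.coe_union, Finset.coe_image,
      Finset.coe_univ, image_univ, mem_union, mem_range, exists_or, sub_eq_iff_eq_add,
      sub_eq_add_neg x, add_comm x, eq_comm (b := y)]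
  have hdisj : Disjoint (Finset.univ.image fun i : Fin d => x + unitVec i)
      (Finset.univ.image fun i : Fin d => x - unitVec i) := by
    rw [Finset.disjoint_left]
    intro y hy hy'
    simp only [Finset.mem_image, Finset.mem_univ, true_and] at hy hy'
    obtain ⟨i, rfl⟩ := hy
    obtain ⟨j, hj⟩ := hy'
    have := congrFun hj i
    by_cases hij : i = j
    · subst hij
      simp [unitVec] at this
      lia
    · simp [unitVec, hij] at this
  rw [hset, finsum_mem_coe_finset, Finset.sum_union hdisj, Finset.sum_image, Finset.sum_image,
    laplacian_apply, Finset.sum_add_distrib]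
  · intro i _ j _ h
    exact hinj (sub_right_injective h)
  · intro i _ j _ h
    exact hinj (add_right_injective x h)

/-- The heat kernel `(e^{-tΔ} 1₀)(x)`, with `e^{-tΔ}` the exponential of the bounded operator
`-tΔ` on `ℓ²(ℤ^d)`. -/
def heatKernel {d : ℕ} (t : ℝ) (x : Fin d → ℤ) : ℝ :=
  NormedSpace.exp (-(t • laplacian d)) (lp.single 2 0 1) x

/-- The integrand `e^{-tΔ} 1₀(x) t^{-1-σ}` of the Riesz kernel. -/
def rieszIntegrand {d : ℕ} (σ : ℝ) (x : Fin d → ℤ) (t : ℝ) : ℝ :=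
  heatKernel t x * t ^ (-1 - σ)

/-- The discrete Riesz kernel `κ_σ`: by convention `κ_0 = 1₀` and `κ_σ(0) = 0` for `σ > 0`;
otherwise `κ_σ(x) = |Γ(-σ)|⁻¹ ∫₀^∞ e^{-tΔ} 1₀(x) t^{-1-σ} dt`. -/
def rieszKernel {d : ℕ} (σ : ℝ) (x : Fin d → ℤ) : ℝ :=
  if σ = 0 then (if x = 0 then 1 else 0)
  else if 0 < σ ∧ x = 0 then 0
  else |Real.Gamma (-σ)|⁻¹ * ∫ t in Ioi (0 : ℝ), rieszIntegrand σ x t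

/-- The constant `C_{d,σ} = 4^σ Γ(d/2 + σ) / (π^{d/2} |Γ(-σ)|)`. -/
def rieszConst (d : ℕ) (σ : ℝ) : ℝ :=
  (4 : ℝ) ^ σ * Real.Gamma ((d : ℝ) / 2 + σ) /
    (Real.pi ^ ((d : ℝ) / 2) * |Real.Gamma (-σ)|)

end DiscreteRiesz

end

/-! At times `t ≥ 1` the lattice heat kernel is close to the continuum Gaussian, and the Gaussian
integrates against `t^(-1-σ)` to exactly the leading term, by the Gamma integral. What must be shown
is that the difference contributes two powers of `|x|` less.

The heat kernel is a product of one-dimensional Fourier integrals in which each frequency may be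
shifted into the complex plane by any real `β_i` (`heatKernel_eq_prod`). The Gaussian kernel has the
same form, with `-ζ²` in place of the symbol, and the two symbols differ by `O(ζ⁴)`. For `t ≥ 1` the
shift `sign(x_i)/√t` gives an error `t^(-d/2-1) exp(-|x|/√t)` (`abs_heatKernel_sub_gaussKernel_le`).
For `t ≤ 1` no comparison is needed: the shift `sign(x_i)(1 - log t)` shows that the heat kernel
itself is tiny (`abs_heatKernel_le_of_le_one`), and so is the Gaussian.

The time integral is split at the diffusive scale `t = |x|²`, and each piece of the error is
`O(|x|^(-d-2σ-2))`. Uniformity in `σ` holds because the exponents of `t` stay away from `-1` and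
because `1/Γ` is entire, hence bounded on compact sets. -/

namespace DiscreteRiesz

/-! ### Fourier representation of the heat kernel with complex frequencies -/

open Complex in
/-- The symbol `2 - e^ζ - e^{-ζ}` of the one-dimensional discrete Laplacian. -/
noncomputable def symbol (ζ : ℂ) : ℂ := 2 - cexp ζ - cexp (-ζ)

theorem continuous_symbol : Continuous symbol := by
  unfold symbol
  fun_prop

/-- The integral `∫ exp(-t (2 - e^ζ - e^{-ζ}) - n ζ) dθ` over `ζ = β + iθ`, `-π < θ ≤ π`. -/
noncomputable def heatFactor (t β : ℝ) (n : ℤ) : ℂ :=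
  ∫ θ in Ioc (-Real.pi) Real.pi,
    Complex.exp (-(t * symbol (β + θ * Complex.I)) - n * (β + θ * Complex.I))

/-- Lebesgue measure on the cube `(-π, π]^d`. -/
noncomputable abbrev cubeMeasure (d : ℕ) : Measure (Fin d → ℝ) :=
  Measure.pi fun _ => volume.restrict (Ioc (-Real.pi) Real.pi)

theorem ae_cubeMeasure_mem_Icc (d : ℕ) :
    ∀ᵐ θ ∂(cubeMeasure d), θ ∈ Icc (fun _ => -Real.pi) (fun _ : Fin d => Real.pi) := by
  rw [cubeMeasure, ← Measure.restrict_pi_pi]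
  refine (ae_restrict_mem (MeasurableSet.univ_pi fun _ => measurableSet_Ioc)).mono fun θ hθ => ?_
  exact ⟨fun i => (hθ i trivial).1.le, fun i => (hθ i trivial).2⟩

theorem exists_norm_le_on_cube {d : ℕ} {f : (Fin d → ℝ) → ℂ} (hf : Continuous f) :
    ∃ M : ℝ, 0 ≤ M ∧ ∀ᵐ θ ∂(cubeMeasure d), ‖f θ‖ ≤ M := by
  obtain ⟨M, hM⟩ := (isCompact_Icc (a := fun _ : Fin d => -Real.pi)
    (b := fun _ => Real.pi)).exists_bound_of_continuousOn hf.continuousOn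
  refine ⟨max M 0, le_max_right _ _, (ae_cubeMeasure_mem_Icc d).mono fun θ hθ => ?_⟩
  exact (hM θ hθ).trans (le_max_left _ _)

theorem integrable_cubeMeasure {d : ℕ} {f : (Fin d → ℝ) → ℂ} (hf : Continuous f) :
    Integrable f (cubeMeasure d) := by
  obtain ⟨M, -, hM⟩ := exists_norm_le_on_cube hf
  exact Integrable.of_bound hf.aestronglyMeasurable M hM

/-- For `n ≠ 0` the antiderivative takes the same value at `±π`, whatever `β` is. This orthogonality
at complex frequency takes the place of a contour shift. -/
theorem integral_character (β : ℝ) (n : ℤ) :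
    ∫ θ in Ioc (-Real.pi) Real.pi, Complex.exp (-(n * ((β : ℂ) + θ * Complex.I)))
      = if n = 0 then 2 * (Real.pi : ℂ) else 0 := by
  have hpi : -Real.pi ≤ Real.pi := by linarith [Real.pi_pos]
  rw [← intervalIntegral.integral_of_le hpi]
  split_ifs with h
  · subst h
    simp
    ring
  · have hc : -((n : ℂ) * Complex.I) ≠ 0 := by simp [h]
    have h1 : ∀ θ : ℝ, Complex.exp (-(n * ((β : ℂ) + θ * Complex.I)))
        = Complex.exp (-(n * β)) * Complex.exp (-((n : ℂ) * Complex.I) * θ) := fun θ => by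
      rw [← Complex.exp_add]
      ring_nf
    simp_rw [h1]
    rw [intervalIntegral.integral_const_mul, integral_exp_mul_complex hc]
    have h2 : Complex.exp (-((n : ℂ) * Complex.I) * (Real.pi : ℝ))
        = Complex.exp (-((n : ℂ) * Complex.I) * ((-Real.pi : ℝ) : ℂ)) := by
      rw [Complex.exp_eq_exp_iff_exists_int]
      refine ⟨-n, ?_⟩
      push_cast
      ring
    rw [h2]
    simp

/-- The Fourier representation of `Δ^k 1₀`, with the frequencies shifted into the complex domain. -/
theorem laplacian_pow_single {d : ℕ} (β : Fin d → ℝ) (k : ℕ) (x : Fin d → ℤ) :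
    (2 * (Real.pi : ℂ)) ^ d * (((laplacian d ^ k) (lp.single 2 0 1) x : ℝ) : ℂ)
      = ∫ θ, (∑ i, symbol (β i + θ i * Complex.I)) ^ k
          * Complex.exp (-∑ i, x i * ((β i : ℂ) + θ i * Complex.I)) ∂(cubeMeasure d) := by
  induction k generalizing x with
  | zero =>
    simp only [pow_zero, one_mul, ← Finset.sum_neg_distrib, Complex.exp_sum,
      one_apply_eq_self, lp.single_apply]
    rw [integral_fintype_prod_eq_prod (μ := fun _ => volume.restrict (Ioc (-Real.pi) Real.pi))
      (fun i (θ : ℝ) => Complex.exp (-(x i * ((β i : ℂ) + θ * Complex.I))))]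
    simp_rw [integral_character]
    by_cases hx : x = 0
    · subst hx
      simp
    · obtain ⟨i, hi⟩ : ∃ i, x i ≠ 0 := by
        by_contra! h
        exact hx (funext h)
      rw [Finset.prod_eq_zero (Finset.mem_univ i) (by simp [hi])]
      simp [hx]
  | succ k ih =>
    set F : (Fin d → ℤ) → (Fin d → ℝ) → ℂ := fun y θ =>
      (∑ i, symbol (β i + θ i * Complex.I)) ^ k
        * Complex.exp (-∑ i, y i * ((β i : ℂ) + θ i * Complex.I)) with hF
    have hint : ∀ y, Integrable (F y) (cubeMeasure d) := fun y => by
      apply integrable_cubeMeasure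
      have := continuous_symbol
      fun_prop
    replace ih : ∀ y, _ = ∫ θ, F y θ ∂(cubeMeasure d) := ih
    rw [pow_succ', mul_apply_eq_comp, laplacian_apply]
    generalize hu : (laplacian d ^ k) (lp.single 2 0 1) = u at ih
    obtain ⟨v, hv⟩ : ∃ v : (Fin d → ℤ) → ℝ, ∀ y, u y = v y := ⟨fun y => u y, fun _ => rfl⟩
    simp only [hv] at ih ⊢
    have hmul : ∀ c a₁ a₂ a₃ a₄ : ℂ,
        c * (a₁ - a₂ + (a₃ - a₄)) = c * a₁ - c * a₂ + (c * a₃ - c * a₄) := by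
      intros
      ring
    rw [Complex.ofReal_sum, Finset.mul_sum]
    simp only [Complex.ofReal_add, Complex.ofReal_sub, hmul, ih]
    have hint2 : ∀ y z, Integrable (fun θ => F y θ - F z θ) (cubeMeasure d) :=
      fun y z => (hint y).sub (hint z)
    have hsub : ∀ y z, ∫ θ, F y θ ∂(cubeMeasure d) - ∫ θ, F z θ ∂(cubeMeasure d)
        = ∫ θ, (F y θ - F z θ) ∂(cubeMeasure d) := fun y z =>
      (integral_sub (hint y) (hint z)).symm
    have hadd : ∀ y z y' z', ∫ θ, (F y θ - F z θ) ∂(cubeMeasure d)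
          + ∫ θ, (F y' θ - F z' θ) ∂(cubeMeasure d)
        = ∫ θ, ((F y θ - F z θ) + (F y' θ - F z' θ)) ∂(cubeMeasure d) := fun y z y' z' =>
      (integral_add (hint2 y z) (hint2 y' z')).symm
    simp only [hsub, hadd]
    have hint4 : ∀ i : Fin d, Integrable (fun θ =>
        (F x θ - F (x + unitVec i) θ) + (F x θ - F (x - unitVec i) θ)) (cubeMeasure d) :=
      fun i => (hint2 _ _).add (hint2 _ _)
    rw [← integral_finsetSum _ fun i _ => hint4 i]
    refine integral_congr_ae (Filter.Eventually.of_forall fun θ => ?_)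
    -- Moving `x` by `±e_i` multiplies the character by `e^(∓ζ_i)`, so the differences in direction
    -- `i` produce exactly the factor `symbol ζ_i`.
    have hshift : ∀ (i : Fin d) (y : Fin d → ℤ) (c : ℤ), (∀ j, y j = x j + c * unitVec i j) →
        Complex.exp (-∑ j, y j * ((β j : ℂ) + θ j * Complex.I))
          = Complex.exp (-∑ j, x j * ((β j : ℂ) + θ j * Complex.I))
            * Complex.exp (-(c * ((β i : ℂ) + θ i * Complex.I))) := by
      intro i y c h
      rw [← Complex.exp_add]
      congr 1
      simp only [h, Int.cast_add, Int.cast_mul, add_mul, Finset.sum_add_distrib, neg_add]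
      congr 2
      rw [Finset.sum_eq_single i]
      · simp [unitVec]
      · intro j _ hj
        simp [unitVec, hj]
      · simp
    simp only [hF]
    rw [pow_succ, mul_assoc, Finset.sum_mul, Finset.mul_sum]
    refine Finset.sum_congr rfl fun i _ => ?_
    rw [hshift i (x + unitVec i) 1 (by simp), hshift i (x - unitVec i) (-1) (by simp [sub_eq_add_neg]),
      symbol]
    push_cast
    simp only [one_mul, neg_mul, neg_neg]
    ring

theorem hasSum_heatKernel {d : ℕ} (t : ℝ) (x : Fin d → ℤ) :
    HasSum (fun k : ℕ => ((k.factorial : ℝ))⁻¹ * ((-t) ^ k * (laplacian d ^ k) (lp.single 2 0 1) x))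
      (heatKernel t x) := by
  have h := NormedSpace.exp_series_hasSum_exp' (𝕂 := ℝ) (-(t • laplacian d))
  have h2 := (h.mapL (ContinuousLinearMap.apply ℝ (EllTwo d) (lp.single 2 0 1))).mapL
    (lp.evalCLM ℝ (fun _ : Fin d → ℤ => ℝ) 2 x)
  have h3 : ∀ k : ℕ, (-(t • laplacian d)) ^ k = (-t) ^ k • laplacian d ^ k := fun k => by
    rw [← neg_smul, smul_pow]
  simp only [h3] at h2
  exact h2

/-- The exponential series is summed under the integral by dominated convergence, the cube being
bounded. The symbol of `Δ` is a sum over coordinates, so its exponential factorises. -/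
theorem heatKernel_eq_prod {d : ℕ} (β : Fin d → ℝ) (t : ℝ) (x : Fin d → ℤ) :
    (2 * (Real.pi : ℂ)) ^ d * (heatKernel t x : ℂ) = ∏ i, heatFactor t (β i) (x i) := by
  have h1 := ((Complex.hasSum_ofReal.mpr (hasSum_heatKernel t x)).mul_left
    ((2 * (Real.pi : ℂ)) ^ d))
  set S : (Fin d → ℝ) → ℂ := fun θ => ∑ i, symbol (β i + θ i * Complex.I) with hS
  set E : (Fin d → ℝ) → ℂ := fun θ => Complex.exp (-∑ i, x i * ((β i : ℂ) + θ i * Complex.I))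
    with hE
  have hSc : Continuous S := by
    have := continuous_symbol
    fun_prop
  have hEc : Continuous E := by fun_prop
  obtain ⟨M, hM0, hM⟩ := exists_norm_le_on_cube hSc
  obtain ⟨K, hK0, hK⟩ := exists_norm_le_on_cube hEc
  have h2 : HasSum (fun k : ℕ => ∫ θ, ((-t * S θ) ^ k / k.factorial) * E θ ∂(cubeMeasure d))
      (∫ θ, Complex.exp (-t * S θ) * E θ ∂(cubeMeasure d)) := by
    refine hasSum_integral_of_dominated_convergence
      (fun k _ => (|t| * M) ^ k / k.factorial * K) ?_ ?_ ?_ ?_ ?_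
    · intro k
      exact Continuous.aestronglyMeasurable (by fun_prop)
    · intro k
      filter_upwards [hM, hK] with θ h h'
      rw [norm_mul, norm_div, norm_pow, norm_mul, norm_neg, Complex.norm_real, Complex.norm_natCast,
        Real.norm_eq_abs]
      gcongr
    · exact Filter.Eventually.of_forall fun _ => (Real.summable_pow_div_factorial _).mul_right _
    · exact integrable_const _
    · refine Filter.Eventually.of_forall fun θ => HasSum.mul_right _ ?_
      rw [Complex.exp_eq_exp_ℂ]
      exact NormedSpace.expSeries_div_hasSum_exp _
  have h3 : ∀ k : ℕ, ∫ θ, ((-t * S θ) ^ k / k.factorial) * E θ ∂(cubeMeasure d)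
      = (2 * (Real.pi : ℂ)) ^ d * ((((k.factorial : ℝ))⁻¹ *
        ((-t) ^ k * (laplacian d ^ k) (lp.single 2 0 1) x) : ℝ) : ℂ) := fun k => by
    have : ∀ θ, ((-t * S θ) ^ k / k.factorial) * E θ
        = ((k.factorial : ℂ)⁻¹ * (-t) ^ k) * (S θ ^ k * E θ) := fun θ => by
      rw [mul_pow]
      ring
    simp_rw [this]
    rw [integral_const_mul, ← laplacian_pow_single]
    push_cast
    ring
  simp_rw [h3] at h2
  rw [h1.unique h2]
  have h4 : ∀ θ : Fin d → ℝ, Complex.exp (-t * S θ) * E θ = ∏ i,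
      Complex.exp (-(t * symbol (β i + θ i * Complex.I))
        - (x i) * (β i + θ i * Complex.I)) := fun θ => by
    rw [← Complex.exp_add, ← Complex.exp_sum, Finset.sum_sub_distrib, Finset.sum_neg_distrib,
      hS, neg_mul, Finset.mul_sum, ← sub_eq_add_neg]
  simp_rw [h4]
  exact integral_fintype_prod_eq_prod (μ := fun _ => volume.restrict (Ioc (-Real.pi) Real.pi))
    (fun i (θ : ℝ) => Complex.exp (-(t * symbol (β i + θ * Complex.I))
        - (x i) * (β i + θ * Complex.I)))

theorem continuous_heatKernel {d : ℕ} (x : Fin d → ℤ) :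
    Continuous fun t : ℝ => heatKernel t x := by
  have : NormedAlgebra ℚ (EllTwo d →L[ℝ] EllTwo d) := NormedAlgebra.restrictScalars ℚ ℝ _
  have h : Continuous fun t : ℝ => NormedSpace.exp (-(t • laplacian d)) :=
    NormedSpace.exp_continuous.comp (by fun_prop)
  exact (lp.evalCLM ℝ (fun _ : Fin d → ℤ => ℝ) 2 x).continuous.comp
    ((ContinuousLinearMap.apply ℝ (EllTwo d) (lp.single 2 0 1)).continuous.comp h)

/-! ### Pointwise comparison of the lattice symbol with `-ζ²` -/

/-- Mean value inequality on a half-plane, which is convex and on which `|exp'| ≤ e^m`. -/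
theorem norm_cexp_sub_cexp_le {A B : ℂ} {m : ℝ} (hA : A.re ≤ m) (hB : B.re ≤ m) :
    ‖Complex.exp A - Complex.exp B‖ ≤ Real.exp m * ‖A - B‖ := by
  refine Convex.norm_image_sub_le_of_norm_hasDerivWithin_le (f' := Complex.exp)
    (s := {c : ℂ | c.re ≤ m}) (fun z _ => (Complex.hasDerivAt_exp z).hasDerivWithinAt)
    (fun z hz => ?_) (convex_halfSpace_re_le m) hB hA
  rw [Complex.norm_exp]
  exact Real.exp_le_exp.mpr hz

/-- In the Taylor polynomials of `e^ζ` and `e^(-ζ)` the odd terms cancel, so the remainder is of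
fourth order. -/
theorem norm_symbol_add_sq_le (ζ : ℂ) : ‖symbol ζ + ζ ^ 2‖ ≤ 2 * ‖ζ‖ ^ 4 * Real.exp ‖ζ‖ := by
  have h1 := Complex.norm_exp_sub_sum_le_norm_mul_exp ζ 4
  have h2 := Complex.norm_exp_sub_sum_le_norm_mul_exp (-ζ) 4
  rw [norm_neg] at h2
  have h3 : symbol ζ + ζ ^ 2
      = -((Complex.exp ζ - ∑ m ∈ Finset.range 4, ζ ^ m / m.factorial)
        + (Complex.exp (-ζ) - ∑ m ∈ Finset.range 4, (-ζ) ^ m / m.factorial)) := by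
    simp only [symbol, Finset.sum_range_succ, Finset.sum_range_zero, Nat.factorial]
    push_cast
    ring
  rw [h3, norm_neg]
  exact (norm_add_le _ _).trans (by linarith)

theorem re_symbol (β θ : ℝ) :
    (symbol (β + θ * Complex.I)).re = 2 - 2 * Real.cosh β * Real.cos θ := by
  simp [symbol, Complex.exp_re, Real.cosh_eq]
  ring

theorem cosh_le_one_add_sq {β : ℝ} (hβ : β ^ 2 ≤ 1) : Real.cosh β ≤ 1 + β ^ 2 := by
  refine (Real.cosh_le_exp_half_sq β).trans ?_
  refine (Real.exp_bound_div_one_sub_of_interval (by positivity) (by linarith)).trans ?_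
  rw [div_le_iff₀ (by linarith)]
  nlinarith [sq_nonneg β]

/-- Write `1 - cosh β cos θ = (1 - cos θ) - (cosh β - 1) + (cosh β - 1)(1 - cos θ)` and drop the
last term, which is nonnegative. The constant `2/5` comes from `π² < 10`. -/
theorem le_re_symbol {β θ : ℝ} (hβ : β ^ 2 ≤ 1) (hθ : |θ| ≤ Real.pi) :
    2 / 5 * θ ^ 2 - 2 * β ^ 2 ≤ (symbol (β + θ * Complex.I)).re := by
  rw [re_symbol]
  have h1 := Real.cos_le_one_sub_mul_cos_sq hθ
  have h2 := cosh_le_one_add_sq hβ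
  have h3 := Real.one_le_cosh β
  have h4 : 1 / 5 * θ ^ 2 ≤ 2 / Real.pi ^ 2 * θ ^ 2 := by
    refine mul_le_mul_of_nonneg_right ?_ (sq_nonneg θ)
    rw [div_le_div_iff₀ (by norm_num) (by positivity)]
    nlinarith [Real.pi_lt_d2, Real.pi_pos]
  have h5 : 0 ≤ (Real.cosh β - 1) * (1 - Real.cos θ) :=
    mul_nonneg (by linarith) (by linarith [Real.cos_le_one θ])
  nlinarith

/-- The constant in the pointwise comparison of the lattice and Gaussian Fourier transforms. -/
noncomputable def compConst : ℝ := 200 * Real.exp 7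

theorem compConst_pos : 0 < compConst := by
  unfold compConst
  positivity

theorem exp_two_le_compConst : Real.exp 2 ≤ compConst := by
  unfold compConst
  nlinarith [Real.exp_le_exp.mpr (show (2 : ℝ) ≤ 7 by norm_num), Real.exp_pos 2]

section Pointwise

variable {t β θ : ℝ}

theorem re_neg_mul_symbol_le (ht : 1 ≤ t) (htβ : t * β ^ 2 ≤ 1) (hθ : |θ| ≤ Real.pi) :
    (-(t * symbol (β + θ * Complex.I))).re ≤ 2 - 2 / 5 * (t * θ ^ 2) := by
  have hβ : β ^ 2 ≤ 1 := by nlinarith [sq_nonneg β]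
  rw [Complex.neg_re, Complex.re_ofReal_mul]
  nlinarith [mul_le_mul_of_nonneg_left (le_re_symbol hβ hθ) (by linarith : (0 : ℝ) ≤ t)]

theorem re_mul_sq_le (ht : 1 ≤ t) (htβ : t * β ^ 2 ≤ 1) :
    (t * ((β : ℂ) + θ * Complex.I) ^ 2).re ≤ 2 - 2 / 5 * (t * θ ^ 2) := by
  have h : (((β : ℂ) + θ * Complex.I) ^ 2).re = β ^ 2 - θ ^ 2 := by
    simp [sq]
  rw [Complex.re_ofReal_mul, h]
  nlinarith [mul_nonneg (by linarith : (0 : ℝ) ≤ t) (sq_nonneg θ)]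

theorem exp_two_sub_le (ht : 1 ≤ t) :
    Real.exp (2 - 2 / 5 * (t * θ ^ 2)) ≤ compConst * Real.exp (-(t / 5) * θ ^ 2) := by
  have h0 : 0 ≤ t * θ ^ 2 := by positivity
  calc Real.exp (2 - 2 / 5 * (t * θ ^ 2)) ≤ Real.exp (2 + -(t / 5) * θ ^ 2) :=
        Real.exp_le_exp.mpr (by linarith)
    _ = Real.exp 2 * Real.exp (-(t / 5) * θ ^ 2) := Real.exp_add _ _
    _ ≤ _ := by
      gcongr
      exact exp_two_le_compConst

theorem norm_lattice_le (ht : 1 ≤ t) (htβ : t * β ^ 2 ≤ 1) (hθ : |θ| ≤ Real.pi) :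
    ‖Complex.exp (-(t * symbol (β + θ * Complex.I)))‖
      ≤ compConst * Real.exp (-(t / 5) * θ ^ 2) := by
  rw [Complex.norm_exp]
  exact (Real.exp_le_exp.mpr (re_neg_mul_symbol_le ht htβ hθ)).trans (exp_two_sub_le ht)

theorem norm_gauss_le (ht : 1 ≤ t) (htβ : t * β ^ 2 ≤ 1) :
    ‖Complex.exp (t * ((β : ℂ) + θ * Complex.I) ^ 2)‖
      ≤ compConst * Real.exp (-(t / 5) * θ ^ 2) := by
  rw [Complex.norm_exp]
  exact (Real.exp_le_exp.mpr (re_mul_sq_le ht htβ)).trans (exp_two_sub_le ht)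

/-- The Gaussian tail outside the cube has no lattice counterpart. Half of its decay, with `θ² ≥ 1`,
yields `e^(-t/5) ≤ 5/t`, hence the same gain `t⁻¹` as inside. -/
theorem norm_gauss_le_of_far (ht : 1 ≤ t) (htβ : t * β ^ 2 ≤ 1) (hθ : Real.pi ≤ |θ|) :
    ‖Complex.exp (t * ((β : ℂ) + θ * Complex.I) ^ 2)‖
      ≤ compConst * t⁻¹ * Real.exp (-(t / 5) * θ ^ 2) := by
  have ht0 : 0 < t := by linarith
  have h1 : (1 : ℝ) ≤ θ ^ 2 := by
    rw [← sq_abs]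
    nlinarith [Real.pi_gt_three]
  rw [Complex.norm_exp]
  refine (Real.exp_le_exp.mpr (re_mul_sq_le ht htβ)).trans ?_
  have h2 : Real.exp (-(t / 5)) ≤ 5 * t⁻¹ := by
    rw [Real.exp_neg, show 5 * t⁻¹ = (t / 5)⁻¹ by field_simp]
    gcongr
    linarith [Real.add_one_le_exp (t / 5)]
  calc Real.exp (2 - 2 / 5 * (t * θ ^ 2))
      ≤ Real.exp (2 + -(t / 5) + -(t / 5) * θ ^ 2) := Real.exp_le_exp.mpr (by nlinarith)
    _ = Real.exp 2 * Real.exp (-(t / 5)) * Real.exp (-(t / 5) * θ ^ 2) := by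
      rw [Real.exp_add, Real.exp_add]
    _ ≤ Real.exp 2 * (5 * t⁻¹) * Real.exp (-(t / 5) * θ ^ 2) := by gcongr
    _ = (5 * Real.exp 2) * t⁻¹ * Real.exp (-(t / 5) * θ ^ 2) := by ring
    _ ≤ _ := by
      gcongr
      unfold compConst
      nlinarith [Real.exp_le_exp.mpr (show (2 : ℝ) ≤ 7 by norm_num), Real.exp_pos 2]

theorem norm_lattice_sub_gauss_le (ht : 1 ≤ t) (htβ : t * β ^ 2 ≤ 1) (hθ : |θ| ≤ Real.pi) :
    ‖Complex.exp (-(t * symbol (β + θ * Complex.I)))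
        - Complex.exp (t * ((β : ℂ) + θ * Complex.I) ^ 2)‖
      ≤ compConst * t⁻¹ * Real.exp (-(t / 5) * θ ^ 2) := by
  have ht0 : 0 < t := by linarith
  refine (norm_cexp_sub_cexp_le (re_neg_mul_symbol_le ht htβ hθ) (re_mul_sq_le ht htβ)).trans ?_
  set ζ : ℂ := (β : ℂ) + θ * Complex.I with hζ
  set u := t * θ ^ 2 with hu
  have hu0 : 0 ≤ u := by positivity
  have hβ : β ^ 2 ≤ 1 := by nlinarith [sq_nonneg β]
  have hnorm2 : ‖ζ‖ ^ 2 = β ^ 2 + θ ^ 2 := by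
    rw [Complex.sq_norm, Complex.normSq_add_mul_I]
  have hnorm : ‖ζ‖ ≤ 5 := by
    refine (norm_add_le _ _).trans ?_
    rw [norm_mul, Complex.norm_I, mul_one, Complex.norm_real, Complex.norm_real, Real.norm_eq_abs,
      Real.norm_eq_abs]
    have : |β| ≤ 1 := by rwa [sq_le_one_iff_abs_le_one] at hβ
    linarith [Real.pi_lt_four]
  have h1 : ‖-(t * symbol ζ) - t * ζ ^ 2‖ ≤ t * (2 * ‖ζ‖ ^ 4 * Real.exp 5) := by
    rw [show -(t * symbol ζ) - t * ζ ^ 2 = -((t : ℂ) * (symbol ζ + ζ ^ 2)) by ring, norm_neg,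
      norm_mul, Complex.norm_real, Real.norm_of_nonneg ht0.le]
    gcongr
    exact (norm_symbol_add_sq_le ζ).trans (by gcongr)
  -- The quartic error is of order `t⁻¹` on the scale `ζ ~ t^(-1/2)`; `tβ² ≤ 1` bounds the rest by a
  -- polynomial in `u`.
  have h2 : t * ‖ζ‖ ^ 4 ≤ t⁻¹ * (1 + u) ^ 2 := by
    have : t * ‖ζ‖ ^ 2 ≤ 1 + u := by
      rw [hnorm2, mul_add]
      linarith
    calc t * ‖ζ‖ ^ 4 = t⁻¹ * (t * ‖ζ‖ ^ 2) ^ 2 := by field_simp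
      _ ≤ _ := by gcongr
  -- The polynomial costs half of the decay rate `2/5`, leaving `e^(-u/5)`. With the factors `2`,
  -- `e²` and `e⁵` this gives `compConst`.
  have h3 : (1 + u) ^ 2 ≤ 100 * Real.exp (u / 5) := by
    have h : 1 + u / 10 ≤ Real.exp (u / 10) := by linarith [Real.add_one_le_exp (u / 10)]
    calc (1 + u) ^ 2 ≤ 100 * (1 + u / 10) ^ 2 := by nlinarith
      _ ≤ 100 * Real.exp (u / 10) ^ 2 := by gcongr
      _ = 100 * Real.exp (u / 5) := by
        rw [← Real.exp_nat_mul]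
        ring_nf
  calc Real.exp (2 - 2 / 5 * u) * ‖-(t * symbol ζ) - t * ζ ^ 2‖
      ≤ Real.exp (2 - 2 / 5 * u) * (2 * (t * ‖ζ‖ ^ 4)) * Real.exp 5 := by
        rw [mul_assoc]
        gcongr
        linarith
    _ ≤ Real.exp (2 - 2 / 5 * u) * (2 * (t⁻¹ * (100 * Real.exp (u / 5)))) * Real.exp 5 := by
        have h4 := h2.trans (mul_le_mul_of_nonneg_left h3 (inv_nonneg.mpr ht0.le))
        exact mul_le_mul_of_nonneg_right (mul_le_mul_of_nonneg_left
          (mul_le_mul_of_nonneg_left h4 zero_le_two) (Real.exp_pos _).le) (Real.exp_pos _).le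
    _ = 200 * (Real.exp (2 - 2 / 5 * u) * Real.exp (u / 5) * Real.exp 5) * t⁻¹ := by ring
    _ = 200 * (Real.exp 7 * Real.exp (-(t / 5) * θ ^ 2)) * t⁻¹ := by
        rw [← Real.exp_add, ← Real.exp_add, ← Real.exp_add]
        congr 3
        rw [hu]
        ring
    _ = _ := by
        unfold compConst
        ring

end Pointwise

/-! ### One-dimensional factors -/

/-- The Gaussian analogue of `heatFactor`. -/
noncomputable def gaussFactor (t β : ℝ) (n : ℤ) : ℂ :=
  ∫ θ : ℝ, Complex.exp (t * ((β : ℂ) + θ * Complex.I) ^ 2 - n * (β + θ * Complex.I))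

/-- Completing the square removes `β`, so the Gaussian can be compared with the lattice factor at
any shift. -/
theorem gaussFactor_eq {t : ℝ} (ht : 0 < t) (β : ℝ) (n : ℤ) :
    gaussFactor t β n = ((√(Real.pi / t) * Real.exp (-(n : ℝ) ^ 2 / (4 * t)) : ℝ) : ℂ) := by
  have hb : (-(t : ℂ)).re < 0 := by simpa using ht
  have htc : (t : ℂ) ≠ 0 := by exact_mod_cast ht.ne'
  have h := integral_cexp_quadratic hb ((2 * β * t - n) * Complex.I) (t * β ^ 2 - n * β)
  rw [gaussFactor]
  have h1 : ∀ θ : ℝ, (t : ℂ) * ((β : ℂ) + θ * Complex.I) ^ 2 - n * (β + θ * Complex.I)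
      = -(t : ℂ) * (θ : ℂ) ^ 2 + (2 * β * t - n) * Complex.I * θ + (t * β ^ 2 - n * β) := fun θ => by
    linear_combination (t : ℂ) * θ ^ 2 * Complex.I_sq
  simp_rw [h1]
  rw [h, Complex.ofReal_mul, Complex.ofReal_exp]
  congr 1
  · rw [Real.sqrt_eq_rpow, Complex.ofReal_cpow (by positivity)]
    push_cast
    rw [neg_neg]
  · congr 1
    push_cast
    rw [mul_pow, Complex.I_sq]
    field_simp
    ring

theorem norm_character (β θ : ℝ) (n : ℤ) :
    ‖Complex.exp (-(n * ((β : ℂ) + θ * Complex.I)))‖ = Real.exp (-(n * β)) := by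
  rw [Complex.norm_exp]
  simp

theorem integral_exp_neg_div_five {t : ℝ} (c : ℝ) (ht : 0 < t) :
    ∫ θ : ℝ, c * Real.exp (-(t / 5) * θ ^ 2) = c * √(5 * Real.pi) * (√t)⁻¹ := by
  rw [integral_const_mul, integral_gaussian, mul_assoc, ← Real.sqrt_inv,
    ← Real.sqrt_mul (by positivity)]
  congr 2
  field_simp

section Factors

variable {t β : ℝ}

theorem heatFactor_eq_integral (t β : ℝ) (n : ℤ) :
    heatFactor t β n = ∫ θ : ℝ, (Ioc (-Real.pi) Real.pi).indicator
      (fun θ : ℝ => Complex.exp (-(t * symbol (β + θ * Complex.I)))) θ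
        * Complex.exp (-(n * ((β : ℂ) + θ * Complex.I))) := by
  rw [heatFactor, ← integral_indicator measurableSet_Ioc]
  congr 1
  ext θ
  by_cases h : θ ∈ Ioc (-Real.pi) Real.pi
  · simp only [indicator_of_mem h, sub_eq_add_neg, Complex.exp_add]
  · simp only [indicator_of_notMem h, zero_mul]

theorem gaussFactor_eq_integral (t β : ℝ) (n : ℤ) :
    gaussFactor t β n = ∫ θ : ℝ, Complex.exp (t * ((β : ℂ) + θ * Complex.I) ^ 2)
        * Complex.exp (-(n * ((β : ℂ) + θ * Complex.I))) := by
  simp only [gaussFactor, sub_eq_add_neg, Complex.exp_add]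

theorem norm_heatIntegrand_le (ht : 1 ≤ t) (htβ : t * β ^ 2 ≤ 1) (n : ℤ) (θ : ℝ) :
    ‖(Ioc (-Real.pi) Real.pi).indicator
      (fun θ : ℝ => Complex.exp (-(t * symbol (β + θ * Complex.I)))) θ
        * Complex.exp (-(n * ((β : ℂ) + θ * Complex.I)))‖
      ≤ compConst * Real.exp (-(n * β)) * Real.exp (-(t / 5) * θ ^ 2) := by
  rw [norm_mul, norm_character, mul_right_comm]
  gcongr
  by_cases h : θ ∈ Ioc (-Real.pi) Real.pi
  · rw [indicator_of_mem h]
    exact norm_lattice_le ht htβ (abs_le.mpr ⟨h.1.le, h.2⟩)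
  · rw [indicator_of_notMem h, norm_zero]
    have := compConst_pos
    positivity

theorem norm_gaussIntegrand_le (ht : 1 ≤ t) (htβ : t * β ^ 2 ≤ 1) (n : ℤ) (θ : ℝ) :
    ‖Complex.exp (t * ((β : ℂ) + θ * Complex.I) ^ 2)
        * Complex.exp (-(n * ((β : ℂ) + θ * Complex.I)))‖
      ≤ compConst * Real.exp (-(n * β)) * Real.exp (-(t / 5) * θ ^ 2) := by
  rw [norm_mul, norm_character, mul_right_comm]
  gcongr
  exact norm_gauss_le ht htβ

theorem integrable_gaussian_bound (c : ℝ) (ht : 1 ≤ t) :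
    Integrable fun θ : ℝ => c * Real.exp (-(t / 5) * θ ^ 2) :=
  (integrable_exp_neg_mul_sq (by positivity)).const_mul c

theorem norm_heatFactor_le (ht : 1 ≤ t) (htβ : t * β ^ 2 ≤ 1) (n : ℤ) :
    ‖heatFactor t β n‖ ≤ compConst * √(5 * Real.pi) * (√t)⁻¹ * Real.exp (-(n * β)) := by
  rw [heatFactor_eq_integral]
  refine (norm_integral_le_of_norm_le (integrable_gaussian_bound _ ht)
    (Filter.Eventually.of_forall (norm_heatIntegrand_le ht htβ n))).trans_eq ?_
  rw [integral_exp_neg_div_five _ (by linarith)]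
  ring

theorem norm_gaussFactor_le (ht : 1 ≤ t) (htβ : t * β ^ 2 ≤ 1) (n : ℤ) :
    ‖gaussFactor t β n‖ ≤ compConst * √(5 * Real.pi) * (√t)⁻¹ * Real.exp (-(n * β)) := by
  rw [gaussFactor_eq_integral]
  refine (norm_integral_le_of_norm_le (integrable_gaussian_bound _ ht)
    (Filter.Eventually.of_forall (norm_gaussIntegrand_le ht htβ n))).trans_eq ?_
  rw [integral_exp_neg_div_five _ (by linarith)]
  ring

theorem norm_heatFactor_sub_gaussFactor_le (ht : 1 ≤ t) (htβ : t * β ^ 2 ≤ 1) (n : ℤ) :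
    ‖heatFactor t β n - gaussFactor t β n‖
      ≤ t⁻¹ * (compConst * √(5 * Real.pi) * (√t)⁻¹ * Real.exp (-(n * β))) := by
  have hsymb := continuous_symbol
  have hi1 : Integrable fun θ : ℝ => (Ioc (-Real.pi) Real.pi).indicator
      (fun θ : ℝ => Complex.exp (-(t * symbol (β + θ * Complex.I)))) θ
        * Complex.exp (-(n * ((β : ℂ) + θ * Complex.I))) := by
    refine (integrable_gaussian_bound _ ht).mono' ?_
      (Filter.Eventually.of_forall (norm_heatIntegrand_le ht htβ n))
    refine AEStronglyMeasurable.mul ?_ (Continuous.aestronglyMeasurable (by fun_prop))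
    exact (Continuous.aestronglyMeasurable (by fun_prop)).indicator measurableSet_Ioc
  have hi2 : Integrable fun θ : ℝ => Complex.exp (t * ((β : ℂ) + θ * Complex.I) ^ 2)
        * Complex.exp (-(n * ((β : ℂ) + θ * Complex.I))) :=
    (integrable_gaussian_bound _ ht).mono' (Continuous.aestronglyMeasurable (by fun_prop))
      (Filter.Eventually.of_forall (norm_gaussIntegrand_le ht htβ n))
  rw [heatFactor_eq_integral, gaussFactor_eq_integral, ← integral_sub hi1 hi2]
  refine (norm_integral_le_of_norm_le
    (integrable_gaussian_bound (compConst * t⁻¹ * Real.exp (-(n * β))) ht)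
    (Filter.Eventually.of_forall fun θ => ?_)).trans_eq ?_
  · rw [← sub_mul, norm_mul, norm_character, mul_right_comm]
    gcongr
    by_cases h : θ ∈ Ioc (-Real.pi) Real.pi
    · rw [indicator_of_mem h]
      exact norm_lattice_sub_gauss_le ht htβ (abs_le.mpr ⟨h.1.le, h.2⟩)
    · rw [indicator_of_notMem h, zero_sub, norm_neg]
      refine norm_gauss_le_of_far ht htβ ?_
      by_contra! hlt
      exact h ⟨(abs_lt.mp hlt).1, (abs_lt.mp hlt).2.le⟩
  · rw [integral_exp_neg_div_five _ (by linarith)]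
    ring

/-- A crude bound with no restriction on `β`, for small times, where the useful shift violates `tβ²
≤ 1`. -/
theorem norm_heatFactor_le_exp (ht : 0 ≤ t) (β : ℝ) (n : ℤ) :
    ‖heatFactor t β n‖
      ≤ 2 * Real.pi * Real.exp (t * (Real.exp β + Real.exp (-β)) - n * β) := by
  have h := norm_setIntegral_le_of_norm_le_const (μ := volume)
    (s := Ioc (-Real.pi) Real.pi) (C := Real.exp (t * (Real.exp β + Real.exp (-β)) - n * β))
    (f := fun θ : ℝ => Complex.exp (-(t * symbol (β + θ * Complex.I)) - n * (β + θ * Complex.I)))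
    (by simp) (fun θ _ => ?_)
  · rw [heatFactor]
    refine h.trans_eq ?_
    rw [Measure.real, Real.volume_Ioc, ENNReal.toReal_ofReal (by linarith [Real.pi_pos])]
    ring
  · rw [Complex.norm_exp]
    refine Real.exp_le_exp.mpr ?_
    rw [Complex.sub_re, Complex.neg_re, Complex.re_ofReal_mul, re_symbol, Real.cosh_eq]
    have h1 : ((n : ℂ) * (β + θ * Complex.I)).re = n * β := by simp
    rw [h1]
    have h2 : Real.exp β + Real.exp (-β) ≥ 0 := by positivity
    nlinarith [mul_nonneg ht (mul_nonneg h2 (by linarith [Real.cos_le_one θ] :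
      0 ≤ 1 - Real.cos θ))]

end Factors

/-! ### Heat kernel estimates on `ℤ^d` -/

/-- The continuum heat kernel `(4πt)^{-d/2} exp(-|x|²/4t)` restricted to `ℤ^d`. -/
noncomputable def gaussKernel {d : ℕ} (t : ℝ) (x : Fin d → ℤ) : ℝ :=
  (4 * Real.pi * t) ^ (-(d : ℝ) / 2) * Real.exp (-latticeNorm x ^ 2 / (4 * t))

/-- The `ℓ¹` norm of a lattice point. -/
def taxicabNorm {d : ℕ} (x : Fin d → ℤ) : ℕ := ∑ i, (x i).natAbs

theorem latticeNorm_sq {d : ℕ} (x : Fin d → ℤ) : latticeNorm x ^ 2 = ∑ i, (x i : ℝ) ^ 2 := by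
  rw [latticeNorm, EuclideanSpace.norm_sq_eq]
  simp

theorem cast_natAbs_real (n : ℤ) : ((n.natAbs : ℕ) : ℝ) = |(n : ℝ)| := by
  rw [Nat.cast_natAbs, Int.cast_abs]

theorem latticeNorm_le_taxicabNorm {d : ℕ} (x : Fin d → ℤ) :
    latticeNorm x ≤ taxicabNorm x := by
  refine le_of_sq_le_sq ?_ (Nat.cast_nonneg _)
  rw [latticeNorm_sq, taxicabNorm]
  push_cast
  have := Finset.sum_sq_le_sq_sum_of_nonneg (s := Finset.univ)
    (f := fun i => (((x i).natAbs : ℕ) : ℝ)) fun i _ => Nat.cast_nonneg _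
  simpa [cast_natAbs_real] using this

theorem one_le_taxicabNorm {d : ℕ} {x : Fin d → ℤ} (hx : x ≠ 0) : 1 ≤ taxicabNorm x := by
  rw [Nat.one_le_iff_ne_zero]
  intro h
  refine hx (funext fun i => ?_)
  have := Finset.sum_eq_zero_iff.mp h i (Finset.mem_univ i)
  simpa using this

theorem rpow_neg_half_eq {t : ℝ} (ht : 0 ≤ t) (d : ℕ) :
    t ^ (-(d : ℝ) / 2) = (√t)⁻¹ ^ d := by
  rw [← Real.sqrt_inv, Real.sqrt_eq_rpow, ← Real.rpow_natCast, ← Real.rpow_mul (by positivity),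
    Real.inv_rpow ht, ← Real.rpow_neg ht]
  congr 1
  ring

theorem gaussKernel_eq_prod {d : ℕ} (β : Fin d → ℝ) {t : ℝ} (ht : 0 < t) (x : Fin d → ℤ) :
    (2 * (Real.pi : ℂ)) ^ d * (gaussKernel t x : ℂ) = ∏ i, gaussFactor t (β i) (x i) := by
  simp_rw [gaussFactor_eq ht]
  rw [← Complex.ofReal_prod, Finset.prod_mul_distrib, ← Real.exp_sum, gaussKernel,
    rpow_neg_half_eq (by positivity), latticeNorm_sq, ← Finset.sum_div, Finset.sum_neg_distrib,
    Finset.prod_const, Finset.card_univ, Fintype.card_fin]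
  have h : √(Real.pi / t) = 2 * Real.pi * (√(4 * Real.pi * t))⁻¹ := by
    rw [Real.sqrt_eq_iff_mul_self_eq (by positivity) (by positivity), mul_mul_mul_comm,
      ← mul_inv, Real.mul_self_sqrt (by positivity)]
    field_simp
    ring
  rw [h, mul_pow]
  push_cast
  ring

/-- Telescoping: one factor is exchanged at a time, each at relative cost `ε`. -/
theorem norm_prod_sub_prod_le {ι : Type*} (s : Finset ι) {a b : ι → ℂ} {M : ι → ℝ} {ε : ℝ}
    (ha : ∀ i, ‖a i‖ ≤ M i) (hb : ∀ i, ‖b i‖ ≤ M i) (hab : ∀ i, ‖a i - b i‖ ≤ ε * M i) :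
    ‖∏ i ∈ s, a i - ∏ i ∈ s, b i‖ ≤ s.card * ε * ∏ i ∈ s, M i := by
  classical
  induction s using Finset.induction_on with
  | empty => simp
  | insert i s hi ih =>
    have hM : ∀ j, 0 ≤ M j := fun j => (norm_nonneg _).trans (ha j)
    have hbs : ‖∏ j ∈ s, b j‖ ≤ ∏ j ∈ s, M j := by
      rw [norm_prod]
      exact Finset.prod_le_prod (fun _ _ => norm_nonneg _) fun j _ => hb j
    rw [Finset.prod_insert hi, Finset.prod_insert hi, Finset.prod_insert hi,
      Finset.card_insert_of_notMem hi]
    calc ‖a i * ∏ j ∈ s, a j - b i * ∏ j ∈ s, b j‖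
        = ‖a i * (∏ j ∈ s, a j - ∏ j ∈ s, b j) + (a i - b i) * ∏ j ∈ s, b j‖ := by ring_nf
      _ ≤ ‖a i‖ * ‖∏ j ∈ s, a j - ∏ j ∈ s, b j‖ + ‖a i - b i‖ * ‖∏ j ∈ s, b j‖ := by
        rw [← norm_mul, ← norm_mul]
        exact norm_add_le _ _
      _ ≤ M i * (s.card * ε * ∏ j ∈ s, M j) + (ε * M i) * ∏ j ∈ s, M j :=
        add_le_add (mul_le_mul (ha i) ih (norm_nonneg _) (hM i))
          (mul_le_mul (hab i) hbs (norm_nonneg _) ((norm_nonneg _).trans (hab i)))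
      _ = _ := by
        push_cast
        ring

theorem abs_le_norm_two_pi_pow_mul (d : ℕ) (r : ℝ) :
    |r| ≤ ‖(2 * (Real.pi : ℂ)) ^ d * (r : ℂ)‖ := by
  have h : ‖(2 * (Real.pi : ℂ))‖ = 2 * Real.pi := by
    rw [norm_mul, Complex.norm_real, Real.norm_of_nonneg Real.pi_pos.le]
    simp
  rw [norm_mul, norm_pow, h, Complex.norm_real, Real.norm_eq_abs]
  exact le_mul_of_one_le_left (abs_nonneg _) (one_le_pow₀ (by linarith [Real.pi_gt_three]))

theorem mul_sign_eq_natAbs (n : ℤ) (b : ℝ) : (n : ℝ) * ((n.sign : ℝ) * b) = n.natAbs * b := by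
  rw [← mul_assoc, ← Int.cast_mul, Int.mul_sign_self, Int.cast_natCast]

/-- A constant in the large time heat kernel bounds. -/
noncomputable def factorConst : ℝ := compConst * √(5 * Real.pi)

theorem factorConst_pos : 0 < factorConst := by
  have := compConst_pos
  unfold factorConst
  positivity

theorem prod_factor_bound {d : ℕ} {t : ℝ} (ht : 0 ≤ t) (x : Fin d → ℤ) :
    ∏ i, (factorConst * (√t)⁻¹ * Real.exp (-((x i : ℝ) * (((x i).sign : ℝ) * (√t)⁻¹))))
      = factorConst ^ d * t ^ (-(d : ℝ) / 2) * Real.exp (-(taxicabNorm x * (√t)⁻¹)) := by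
  simp_rw [mul_sign_eq_natAbs]
  rw [Finset.prod_mul_distrib, ← Real.exp_sum, Finset.prod_const, Finset.card_univ,
    Fintype.card_fin, mul_pow, rpow_neg_half_eq ht, Finset.sum_neg_distrib, ← Finset.sum_mul,
    taxicabNorm]
  push_cast
  rfl

/-- This shift has the largest size allowed by `tβ² ≤ 1`, with the sign that makes `e^(-nβ)` decay.
-/
theorem mul_sign_div_sqrt_sq_le {t : ℝ} (ht : 1 ≤ t) (n : ℤ) :
    t * ((n.sign : ℝ) * (√t)⁻¹) ^ 2 ≤ 1 := by
  have h : ((n.sign : ℝ)) ^ 2 ≤ 1 := by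
    rcases lt_trichotomy n 0 with h | h | h
    · simp [Int.sign_eq_neg_one_of_neg h]
    · simp [h]
    · simp [Int.sign_eq_one_of_pos h]
  rw [mul_pow, inv_pow, Real.sq_sqrt (by linarith)]
  have : t * ((n.sign : ℝ) ^ 2 * t⁻¹) = (n.sign : ℝ) ^ 2 := by
    field_simp
  rwa [this]

theorem abs_heatKernel_le_of_one_le {d : ℕ} {t : ℝ} (ht : 1 ≤ t) (x : Fin d → ℤ) :
    |heatKernel t x| ≤ factorConst ^ d * t ^ (-(d : ℝ) / 2) := by
  have hc := factorConst_pos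
  refine (abs_le_norm_two_pi_pow_mul d _).trans ?_
  rw [heatKernel_eq_prod (fun i => ((x i).sign : ℝ) * (√t)⁻¹), norm_prod]
  refine (Finset.prod_le_prod (fun _ _ => norm_nonneg _) fun i _ =>
    norm_heatFactor_le ht (mul_sign_div_sqrt_sq_le ht (x i)) (x i)).trans ?_
  refine (prod_factor_bound (by linarith) x).trans_le ?_
  refine mul_le_of_le_one_right (by positivity) (Real.exp_le_one_iff.mpr ?_)
  simp only [Left.neg_nonpos_iff]
  positivity

theorem abs_heatKernel_sub_gaussKernel_le {d : ℕ} {t : ℝ} (ht : 1 ≤ t) (x : Fin d → ℤ) :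
    |heatKernel t x - gaussKernel t x| ≤ d * factorConst ^ d * t ^ (-(d : ℝ) / 2 - 1)
      * Real.exp (-(latticeNorm x * (√t)⁻¹)) := by
  have hc := factorConst_pos
  have ht0 : 0 < t := by linarith
  refine (abs_le_norm_two_pi_pow_mul d _).trans ?_
  rw [Complex.ofReal_sub, mul_sub, heatKernel_eq_prod (fun i => ((x i).sign : ℝ) * (√t)⁻¹),
    gaussKernel_eq_prod (fun i => ((x i).sign : ℝ) * (√t)⁻¹) ht0]
  have hβ := fun i => mul_sign_div_sqrt_sq_le ht (x i)
  refine (norm_prod_sub_prod_le Finset.univ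
    (fun i => norm_heatFactor_le ht (hβ i) (x i))
    (fun i => norm_gaussFactor_le ht (hβ i) (x i))
    (fun i => norm_heatFactor_sub_gaussFactor_le ht (hβ i) (x i))).trans ?_
  have h := prod_factor_bound ht0.le x
  unfold factorConst at h ⊢
  rw [h, Real.rpow_sub_one ht0.ne', Finset.card_univ, Fintype.card_fin]
  have h2 : Real.exp (-(taxicabNorm x * (√t)⁻¹)) ≤ Real.exp (-(latticeNorm x * (√t)⁻¹)) := by
    gcongr
    exact latticeNorm_le_taxicabNorm x
  calc _ = d * (compConst * √(5 * Real.pi)) ^ d * (t ^ (-(d : ℝ) / 2) / t)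
        * Real.exp (-(taxicabNorm x * (√t)⁻¹)) := by ring
    _ ≤ _ := by
        have := compConst_pos
        gcongr

/-- For `n ≠ 0` the shift has `e^|β| = e/t`, so `t(e^β + e^(-β))` stays bounded while `e^(-nβ) =
t^|n| e^(-|n|)`. The summand `1` in `1 - log t` supplies the decay in `n` that persists at `t = 1`.
-/
theorem norm_heatFactor_le_of_le_one {t : ℝ} (ht : 0 < t) (ht1 : t ≤ 1) (n : ℤ) :
    ‖heatFactor t ((n.sign : ℝ) * (1 - Real.log t)) n‖
      ≤ 2 * Real.pi * (Real.exp 4 * (t ^ n.natAbs * Real.exp (-n.natAbs))) := by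
  refine (norm_heatFactor_le_exp ht.le _ n).trans ?_
  have h1 : t * (Real.exp (n.sign * (1 - Real.log t)) + Real.exp (-(n.sign * (1 - Real.log t))))
      ≤ 4 := by
    have hpos : Real.exp (1 - Real.log t) = Real.exp 1 / t := by
      rw [Real.exp_sub, Real.exp_log ht]
    have hneg : Real.exp (-(1 - Real.log t)) = t / Real.exp 1 := by
      rw [Real.exp_neg, hpos, inv_div]
    have he := Real.exp_one_lt_d9
    have hsum : t * (Real.exp 1 / t + t / Real.exp 1) ≤ 4 := by
      have h2 : t * (t / Real.exp 1) ≤ 1 := by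
        have : t / Real.exp 1 ≤ 1 := by
          rw [div_le_one (Real.exp_pos _)]
          linarith [Real.add_one_le_exp (1 : ℝ)]
        nlinarith
      rw [mul_add, mul_div_cancel₀ _ ht.ne']
      linarith
    rcases lt_trichotomy n 0 with h | h | h
    · rw [Int.sign_eq_neg_one_of_neg h]
      push_cast
      rw [neg_one_mul, neg_neg, hpos, hneg]
      linarith
    · simp [h]
      linarith
    · rw [Int.sign_eq_one_of_pos h]
      push_cast
      rw [one_mul, hpos, hneg]
      exact hsum
  have h3 : t ^ n.natAbs = Real.exp (n.natAbs * Real.log t) := by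
    rw [← Real.log_pow, Real.exp_log (by positivity)]
  rw [mul_sign_eq_natAbs, h3, ← Real.exp_add, ← Real.exp_add]
  gcongr
  linarith

theorem abs_heatKernel_le_of_le_one {d : ℕ} {t : ℝ} (ht : 0 < t) (ht1 : t ≤ 1) (x : Fin d → ℤ) :
    |heatKernel t x| ≤ Real.exp 4 ^ d * (t ^ taxicabNorm x * Real.exp (-taxicabNorm x)) := by
  have h2pi : 0 < (2 * Real.pi) ^ d := by positivity
  have h : (2 * Real.pi) ^ d * |heatKernel t x| = ‖(2 * (Real.pi : ℂ)) ^ d * (heatKernel t x : ℂ)‖ := by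
    rw [norm_mul, norm_pow, norm_mul, Complex.norm_real, Complex.norm_real,
      Real.norm_of_nonneg Real.pi_pos.le, Real.norm_eq_abs]
    simp
  rw [← mul_le_mul_iff_right₀ h2pi, h,
    heatKernel_eq_prod (fun i => ((x i).sign : ℝ) * (1 - Real.log t)), norm_prod]
  refine (Finset.prod_le_prod (fun _ _ => norm_nonneg _) fun i _ =>
    norm_heatFactor_le_of_le_one ht ht1 (x i)).trans_eq ?_
  have he : ∏ i, Real.exp (-((x i).natAbs : ℝ)) = Real.exp (-taxicabNorm x) := by
    rw [← Real.exp_sum, Finset.sum_neg_distrib, taxicabNorm, Nat.cast_sum]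
  simp only [Finset.prod_mul_distrib, he, Finset.prod_pow_eq_pow_sum, Finset.prod_const,
    Finset.card_univ, Fintype.card_fin, taxicabNorm]
  ring

theorem exp_neg_le_factorial_div_pow {u : ℝ} (hu : 0 < u) (n : ℕ) :
    Real.exp (-u) ≤ n.factorial / u ^ n := by
  have := Real.pow_div_factorial_le_exp u hu.le n
  rw [Real.exp_neg, ← inv_div]
  gcongr

/-- Away from the origin the heat kernel and its Gaussian approximation differ by
`O(t^{-d/2-1})`, with arbitrary polynomial decay in `|x|²/t`. -/
theorem exists_heatKernel_sub_gaussKernel_bound (d N : ℕ) :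
    ∃ C : ℝ, 0 ≤ C ∧ ∀ x : Fin d → ℤ, (N : ℝ) ≤ latticeNorm x → 1 ≤ latticeNorm x →
      (∀ t : ℝ, 0 < t → |heatKernel t x - gaussKernel t x|
        ≤ C * t ^ (-(d : ℝ) / 2 - 1) * (t / latticeNorm x ^ 2) ^ N) ∧
      (∀ t : ℝ, 1 ≤ t → |heatKernel t x - gaussKernel t x| ≤ C * t ^ (-(d : ℝ) / 2 - 1)) := by
  have hc := factorConst_pos
  set A : ℝ := d * factorConst ^ d with hA
  set C : ℝ := A + A * (2 * N).factorial + Real.exp 4 ^ d * (2 * N).factorial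
    + N.factorial * 4 ^ N with hC
  have hA0 : 0 ≤ A := by positivity
  refine ⟨C, by positivity, fun x hxN hx1 => ⟨fun t ht => ?_, fun t ht => ?_⟩⟩
  · have hx0 : 0 < latticeNorm x := by linarith
    rcases le_total 1 t with h1 | h1
    · refine (abs_heatKernel_sub_gaussKernel_le h1 x).trans ?_
      have h2 := exp_neg_le_factorial_div_pow (u := latticeNorm x * (√t)⁻¹) (by positivity) (2 * N)
      have h3 : (latticeNorm x * (√t)⁻¹) ^ (2 * N) = ((t / latticeNorm x ^ 2) ^ N)⁻¹ := by
        rw [pow_mul, mul_pow, inv_pow √t, Real.sq_sqrt ht.le, ← inv_pow, inv_div, div_eq_mul_inv]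
      rw [h3, div_inv_eq_mul] at h2
      calc _ ≤ A * t ^ (-(d : ℝ) / 2 - 1)
            * ((2 * N).factorial * (t / latticeNorm x ^ 2) ^ N) := by gcongr
        _ = A * (2 * N).factorial * t ^ (-(d : ℝ) / 2 - 1) * (t / latticeNorm x ^ 2) ^ N := by ring
        _ ≤ _ := by
          gcongr
          have : 0 ≤ Real.exp 4 ^ d * (2 * N).factorial + N.factorial * 4 ^ N := by positivity
          linarith
    -- For `t ≤ 1` the two kernels are bounded separately; the weight `t^(-d/2-1)` is at least `1`
    -- here and comes for free.
    · have hone : 1 ≤ t ^ (-(d : ℝ) / 2 - 1) :=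
        Real.one_le_rpow_of_pos_of_le_one_of_nonpos ht h1 (by
          have : (0 : ℝ) ≤ d := by positivity
          linarith)
      have hp : |heatKernel t x|
          ≤ Real.exp 4 ^ d * (2 * N).factorial * (t / latticeNorm x ^ 2) ^ N := by
        refine (abs_heatKernel_le_of_le_one ht h1 x).trans ?_
        have hle := latticeNorm_le_taxicabNorm x
        -- Since `|x| ≥ N`, the power `t^‖x‖₁` is at most `t^N`.
        have hNl : N ≤ taxicabNorm x := by exact_mod_cast hxN.trans hle
        have h2 : Real.exp (-taxicabNorm x) ≤ (2 * N).factorial / latticeNorm x ^ (2 * N) :=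
          (Real.exp_le_exp.mpr (by linarith)).trans (exp_neg_le_factorial_div_pow hx0 _)
        calc _ ≤ Real.exp 4 ^ d * (t ^ N * ((2 * N).factorial / latticeNorm x ^ (2 * N))) := by
              have hpow : t ^ taxicabNorm x ≤ t ^ N := pow_le_pow_of_le_one ht.le h1 hNl
              gcongr
          _ = _ := by
              rw [div_pow, ← pow_mul]
              ring
      have hg : |gaussKernel t x|
          ≤ N.factorial * 4 ^ N * t ^ (-(d : ℝ) / 2 - 1) * (t / latticeNorm x ^ 2) ^ N := by
        have h2 := exp_neg_le_factorial_div_pow (u := latticeNorm x ^ 2 / (4 * t))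
          (by positivity) N
        have h3 : (N.factorial : ℝ) / (latticeNorm x ^ 2 / (4 * t)) ^ N
            = N.factorial * 4 ^ N * (t / latticeNorm x ^ 2) ^ N := by
          rw [mul_assoc, ← mul_pow, div_eq_mul_inv, ← inv_pow, inv_div, mul_div_assoc]
        have h4 : (4 * Real.pi * t) ^ (-(d : ℝ) / 2) ≤ t ^ (-(d : ℝ) / 2 - 1) := by
          calc _ ≤ t ^ (-(d : ℝ) / 2) :=
                Real.rpow_le_rpow_of_nonpos ht (by nlinarith [Real.pi_gt_three])
                  (by
                    have : (0 : ℝ) ≤ d := by positivity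
                    linarith)
            _ ≤ _ := Real.rpow_le_rpow_of_exponent_ge ht h1 (by linarith)
        rw [gaussKernel, abs_of_nonneg (by positivity), neg_div (4 * t)]
        rw [h3] at h2
        calc _ ≤ t ^ (-(d : ℝ) / 2 - 1)
              * (N.factorial * 4 ^ N * (t / latticeNorm x ^ 2) ^ N) := by gcongr
          _ = _ := by ring
      refine (abs_sub _ _).trans ((add_le_add hp hg).trans ?_)
      set P := t ^ (-(d : ℝ) / 2 - 1)
      set Q := (t / latticeNorm x ^ 2) ^ N
      have hQ : 0 ≤ Q := by positivity
      have h5 : Real.exp 4 ^ d * (2 * N).factorial * Q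
          ≤ (Real.exp 4 ^ d * (2 * N).factorial) * P * Q :=
        mul_le_mul_of_nonneg_right (le_mul_of_one_le_right (by positivity) hone) hQ
      have h6 : 0 ≤ (A + A * (2 * N).factorial) * P * Q := by positivity
      rw [hC]
      linarith
  · have ht0 : 0 < t := by linarith
    refine (abs_heatKernel_sub_gaussKernel_le ht x).trans ?_
    have h2 : Real.exp (-(latticeNorm x * (√t)⁻¹)) ≤ 1 := by
      rw [Real.exp_le_one_iff, Left.neg_nonpos_iff]
      positivity
    refine (mul_le_of_le_one_right (by positivity) h2).trans ?_
    gcongr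
    have : 0 ≤ A * (2 * N).factorial + Real.exp 4 ^ d * (2 * N).factorial
      + N.factorial * 4 ^ N := by positivity
    linarith

/-! ### Convergence of the Riesz integral and its Gaussian counterpart -/

theorem ne_zero_of_latticeNorm_pos {d : ℕ} {x : Fin d → ℤ} (hx : 0 < latticeNorm x) : x ≠ 0 := by
  rintro rfl
  norm_num [latticeNorm, ← Pi.zero_def] at hx

theorem continuousOn_rieszIntegrand {d : ℕ} (σ : ℝ) (x : Fin d → ℤ) :
    ContinuousOn (rieszIntegrand σ x) (Ioi 0) := by
  refine (continuous_heatKernel x).continuousOn.mul fun t ht => ?_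
  exact (Real.continuousAt_rpow_const _ _ (Or.inl (ne_of_gt ht))).continuousWithinAt

theorem integrableOn_Ioc_rpow {e : ℝ} (he : -1 < e) (L : ℝ) (hL : 0 ≤ L) :
    IntegrableOn (fun t : ℝ => t ^ e) (Ioc 0 L) :=
  (intervalIntegrable_iff_integrableOn_Ioc_of_le hL).mp
    (intervalIntegral.intervalIntegrable_rpow' he)

theorem integrableOn_rieszIntegrand {d : ℕ} {σ : ℝ} (hσ : -(d : ℝ) / 2 < σ) (hσ1 : σ < 1)
    (hσ0 : σ ≠ 0) {x : Fin d → ℤ} (hx : 0 < σ → x ≠ 0) :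
    IntegrableOn (rieszIntegrand σ x) (Ioi 0) := by
  have hcont := continuousOn_rieszIntegrand σ x
  rw [← Ioc_union_Ioi_eq_Ioi (zero_le_one' ℝ), integrableOn_union]
  constructor
  · have hmeas : AEStronglyMeasurable (rieszIntegrand σ x) (volume.restrict (Ioc 0 1)) :=
      (hcont.mono Ioc_subset_Ioi_self).aestronglyMeasurable measurableSet_Ioc
    -- Near `t = 0` the heat kernel is `O(t^k)`. For `σ < 0` the choice `k = 0` suffices; for `σ >
    -- 0`, `x ≠ 0` allows `k = 1`, which suffices as `σ < 1`.
    obtain ⟨k, hk, hkσ⟩ : ∃ k : ℕ, k ≤ taxicabNorm x ∧ -1 < (k : ℝ) + (-1 - σ) := by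
      rcases lt_or_gt_of_ne hσ0 with h | h
      · exact ⟨0, Nat.zero_le _, by simpa using h⟩
      · exact ⟨1, one_le_taxicabNorm (hx h), by push_cast; linarith⟩
    refine ((integrableOn_Ioc_rpow hkσ 1 zero_le_one).const_mul (Real.exp 4 ^ d)).mono' hmeas ?_
    refine (ae_restrict_mem measurableSet_Ioc).mono fun t ht => ?_
    rw [rieszIntegrand, norm_mul, Real.norm_eq_abs, Real.norm_of_nonneg (Real.rpow_nonneg ht.1.le _),
      Real.rpow_add ht.1, Real.rpow_natCast, ← mul_assoc]
    have hpow : t ^ taxicabNorm x ≤ t ^ k := pow_le_pow_of_le_one ht.1.le ht.2 hk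
    have hexp : Real.exp (-taxicabNorm x) ≤ 1 := by simp
    have hpos := ht.1
    refine mul_le_mul_of_nonneg_right ((abs_heatKernel_le_of_le_one ht.1 ht.2 x).trans ?_)
      (Real.rpow_nonneg ht.1.le _)
    gcongr
    exact (mul_le_of_le_one_right (by positivity) hexp).trans hpow
  · have hmeas : AEStronglyMeasurable (rieszIntegrand σ x) (volume.restrict (Ioi 1)) :=
      (hcont.mono (Ioi_subset_Ioi zero_le_one)).aestronglyMeasurable measurableSet_Ioi
    refine ((integrableOn_Ioi_rpow_of_lt (a := -(d : ℝ) / 2 + (-1 - σ)) (by linarith)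
      zero_lt_one).const_mul (factorConst ^ d)).mono' hmeas ?_
    refine (ae_restrict_mem measurableSet_Ioi).mono fun t ht => ?_
    have ht0 : (0 : ℝ) < t := zero_lt_one.trans ht
    rw [rieszIntegrand, norm_mul, Real.norm_eq_abs, Real.norm_of_nonneg (Real.rpow_nonneg ht0.le _),
      Real.rpow_add ht0, ← mul_assoc]
    exact mul_le_mul_of_nonneg_right (abs_heatKernel_le_of_one_le (le_of_lt ht) x)
      (Real.rpow_nonneg ht0.le _)

/-- The substitution `t ↦ 1/t` turns this into Euler's Gamma integral. -/
theorem integral_rpow_mul_exp_neg_div_Ioi {a r : ℝ} (ha : 0 < a) (hr : 0 < r) :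
    ∫ t in Ioi (0 : ℝ), t ^ (-a - 1) * Real.exp (-(r / t)) = (1 / r) ^ a * Real.Gamma a := by
  rw [← Real.integral_rpow_mul_exp_neg_mul_Ioi ha hr,
    ← integral_comp_rpow_Ioi _ (show (-1 : ℝ) ≠ 0 by norm_num)]
  refine setIntegral_congr_fun measurableSet_Ioi fun t ht => ?_
  have ht0 : (0 : ℝ) < t := ht
  simp only [smul_eq_mul, abs_neg, abs_one, one_mul]
  rw [Real.rpow_neg_one, Real.inv_rpow ht0.le, ← Real.rpow_neg ht0.le, ← mul_assoc,
    ← Real.rpow_add ht0, div_inv_eq_mul]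
  congr 2
  ring

theorem rpow_neg_mul_gaussKernel {d : ℕ} (σ : ℝ) (x : Fin d → ℤ) {t : ℝ} (ht : 0 < t) :
    gaussKernel t x * t ^ (-1 - σ) = (4 * Real.pi) ^ (-(d : ℝ) / 2) *
      (t ^ (-((d : ℝ) / 2 + σ) - 1) * Real.exp (-(latticeNorm x ^ 2 / 4 / t))) := by
  rw [gaussKernel, Real.mul_rpow (by positivity) ht.le,
    show -((d : ℝ) / 2 + σ) - 1 = -(d : ℝ) / 2 + (-1 - σ) by ring, Real.rpow_add ht, neg_div (4 * t),
    div_div]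
  ring

theorem integral_gaussKernel {d : ℕ} {σ : ℝ} (hσ : -(d : ℝ) / 2 < σ) {x : Fin d → ℤ}
    (hx : 0 < latticeNorm x) :
    ∫ t in Ioi (0 : ℝ), gaussKernel t x * t ^ (-1 - σ)
      = 4 ^ σ * Real.Gamma ((d : ℝ) / 2 + σ) / Real.pi ^ ((d : ℝ) / 2)
        * latticeNorm x ^ (-(d : ℝ) - 2 * σ) := by
  rw [setIntegral_congr_fun measurableSet_Ioi fun t ht => rpow_neg_mul_gaussKernel σ x ht,
    integral_const_mul, integral_rpow_mul_exp_neg_div_Ioi (by linarith) (by positivity)]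
  rw [one_div, inv_div, Real.div_rpow (by norm_num) (by positivity), Real.mul_rpow (by norm_num)
    Real.pi_pos.le, Real.rpow_add (by norm_num : (0 : ℝ) < 4), neg_div,
    Real.rpow_neg (by norm_num : (0 : ℝ) ≤ 4), Real.rpow_neg Real.pi_pos.le,
    show -(d : ℝ) - 2 * σ = -(2 * ((d : ℝ) / 2 + σ)) by ring, Real.rpow_neg hx.le,
    Real.rpow_mul hx.le, Real.rpow_two]
  have h4 : (4 : ℝ) ^ ((d : ℝ) / 2) ≠ 0 := by positivity
  field_simp

theorem integrableOn_gaussKernel {d : ℕ} {σ : ℝ} (hσ : -(d : ℝ) / 2 < σ) {x : Fin d → ℤ}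
    (hx : 0 < latticeNorm x) :
    IntegrableOn (fun t => gaussKernel t x * t ^ (-1 - σ)) (Ioi 0) := by
  -- The integral of a non-integrable function is `0` by convention, so a nonzero value proves
  -- integrability.
  refine Integrable.of_integral_ne_zero ?_
  rw [integral_gaussKernel hσ hx]
  have := Real.Gamma_pos_of_pos (show 0 < (d : ℝ) / 2 + σ by linarith)
  positivity

/-! ### The error integral, uniformly in `σ` -/

/-- With `e ≥ 0` the factor `1/(e+1)` is at most `1`, so the bound has no constant depending on `e`,
and thus none on `σ`. The tail estimate below uses `e ≤ -2` in the same way. -/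
theorem norm_setIntegral_Ioc_le {f : ℝ → ℝ} {B e L : ℝ} (hL : 0 < L) (he : 0 ≤ e) (hB : 0 ≤ B)
    (hf : ∀ t ∈ Ioc 0 L, ‖f t‖ ≤ B * t ^ e) : ‖∫ t in Ioc 0 L, f t‖ ≤ B * L ^ (e + 1) := by
  refine (norm_integral_le_of_norm_le
    ((integrableOn_Ioc_rpow (by linarith) L hL.le).const_mul B)
    ((ae_restrict_mem measurableSet_Ioc).mono hf)).trans ?_
  rw [integral_const_mul, ← intervalIntegral.integral_of_le hL.le,
    integral_rpow (Or.inl (by linarith)), Real.zero_rpow (by linarith), sub_zero]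
  gcongr
  exact div_le_self (by positivity) (by linarith)

theorem norm_setIntegral_Ioi_le {f : ℝ → ℝ} {B e L : ℝ} (hL : 0 < L) (he : e ≤ -2) (hB : 0 ≤ B)
    (hf : ∀ t ∈ Ioi L, ‖f t‖ ≤ B * t ^ e) : ‖∫ t in Ioi L, f t‖ ≤ B * L ^ (e + 1) := by
  refine (norm_integral_le_of_norm_le
    ((integrableOn_Ioi_rpow_of_lt (by linarith) hL).const_mul B)
    ((ae_restrict_mem measurableSet_Ioi).mono hf)).trans ?_
  rw [integral_const_mul, integral_Ioi_rpow_of_lt (by linarith) hL, neg_div, ← div_neg]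
  gcongr
  exact div_le_self (by positivity) (by linarith)

/-- The heat integral of `κ_σ` agrees with the Gaussian one up to `O(|x|^{-d-2σ-2})`, uniformly
in `σ`. -/
theorem exists_integral_sub_bound (d : ℕ) :
    ∃ C R : ℝ, 0 ≤ C ∧ 1 ≤ R ∧ ∀ σ : ℝ, -(d : ℝ) / 2 < σ → σ < 1 → σ ≠ 0 → ∀ x : Fin d → ℤ,
      R ≤ latticeNorm x →
      |(∫ t in Ioi (0 : ℝ), rieszIntegrand σ x t)
          - ∫ t in Ioi (0 : ℝ), gaussKernel t x * t ^ (-1 - σ)|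
        ≤ C * latticeNorm x ^ (-(d : ℝ) - 2 * σ - 2) := by
  -- With `N = d + 3` the exponent on `(0, |x|²]` is `d/2 + 1 - σ > 0`. On the tail it is `-d/2 - 2
  -- - σ < -2` without any help from `N`.
  obtain ⟨C, hC0, hC⟩ := exists_heatKernel_sub_gaussKernel_bound d (d + 3)
  refine ⟨2 * C, d + 3, by positivity, by linarith [(Nat.cast_nonneg d : (0 : ℝ) ≤ d)],
    fun σ hσ hσ1 hσ0 x hx => ?_⟩
  have hd0 : (0 : ℝ) ≤ d := Nat.cast_nonneg d
  have hx1 : 1 ≤ latticeNorm x := by linarith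
  have hx0 : 0 < latticeNorm x := by linarith
  have hxne : x ≠ 0 := ne_zero_of_latticeNorm_pos hx0
  obtain ⟨hsmall, hlarge⟩ := hC x (by push_cast; exact hx) hx1
  have hint1 := integrableOn_rieszIntegrand hσ hσ1 hσ0 (x := x) fun _ => hxne
  have hint2 := integrableOn_gaussKernel hσ hx0
  set L := latticeNorm x ^ 2 with hL
  have hL1 : 1 ≤ L := one_le_pow₀ hx1
  have hL0 : 0 < L := by linarith
  rw [← integral_sub hint1 hint2]
  have hint : IntegrableOn (fun t => rieszIntegrand σ x t - gaussKernel t x * t ^ (-1 - σ))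
      (Ioi 0) := hint1.sub hint2
  rw [← Ioc_union_Ioi_eq_Ioi hL0.le] at hint ⊢
  rw [setIntegral_union Ioc_disjoint_Ioi_same measurableSet_Ioi hint.left_of_union
    hint.right_of_union, ← Real.norm_eq_abs]
  refine (norm_add_le _ _).trans ?_
  have hfactor : ∀ t : ℝ, 0 < t → ‖rieszIntegrand σ x t - gaussKernel t x * t ^ (-1 - σ)‖
      = |heatKernel t x - gaussKernel t x| * t ^ (-1 - σ) := fun t ht => by
    rw [rieszIntegrand, ← sub_mul, norm_mul, Real.norm_eq_abs,
      Real.norm_of_nonneg (Real.rpow_nonneg ht.le _)]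
  have h1 : ‖∫ t in Ioc 0 L, (rieszIntegrand σ x t - gaussKernel t x * t ^ (-1 - σ))‖
      ≤ C * (L ^ (d + 3))⁻¹
        * L ^ ((-(d : ℝ) / 2 - 1 + (-1 - σ) + ((d + 3 : ℕ) : ℝ)) + 1) := by
    refine norm_setIntegral_Ioc_le hL0 (by push_cast; linarith) (by positivity) fun t ht => ?_
    rw [hfactor t ht.1, Real.rpow_add ht.1, Real.rpow_add ht.1, Real.rpow_natCast]
    refine (mul_le_mul_of_nonneg_right (hsmall t ht.1) (Real.rpow_nonneg ht.1.le _)).trans_eq ?_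
    rw [div_pow]
    ring
  have h2 : ‖∫ t in Ioi L, (rieszIntegrand σ x t - gaussKernel t x * t ^ (-1 - σ))‖
      ≤ C * L ^ ((-(d : ℝ) / 2 - 1 + (-1 - σ)) + 1) := by
    refine norm_setIntegral_Ioi_le hL0 (by linarith) hC0 fun t ht => ?_
    have ht0 : 0 < t := hL0.trans ht
    rw [hfactor t ht0, Real.rpow_add ht0, ← mul_assoc]
    exact mul_le_mul_of_nonneg_right (hlarge t (hL1.trans (le_of_lt ht)))
      (Real.rpow_nonneg ht0.le _)
  have h3 : L ^ ((-(d : ℝ) / 2 - 1 + (-1 - σ) + ((d + 3 : ℕ) : ℝ)) + 1)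
      = L ^ ((-(d : ℝ) / 2 - 1 + (-1 - σ)) + 1) * L ^ (d + 3) := by
    rw [← Real.rpow_natCast L, ← Real.rpow_add hL0]
    congr 1
    ring
  have h4 : L ^ ((-(d : ℝ) / 2 - 1 + (-1 - σ)) + 1) = latticeNorm x ^ (-(d : ℝ) - 2 * σ - 2) := by
    rw [hL, ← Real.rpow_natCast, ← Real.rpow_mul hx0.le]
    congr 1
    push_cast
    ring
  have h5 : (L ^ (d + 3)) ≠ 0 := by positivity
  refine (add_le_add h1 h2).trans_eq ?_
  rw [h3, h4]
  field_simp
  ring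

/-- `1/Γ` is entire, so compactness gives a bound even across the poles of `Γ(-σ)`, such as `σ = 0`
and `σ = 1`. -/
theorem exists_inv_Gamma_neg_bound (a b : ℝ) :
    ∃ B : ℝ, ∀ σ ∈ Icc a b, |Real.Gamma (-σ)|⁻¹ ≤ B := by
  have hcont : Continuous fun σ : ℝ => (Complex.Gamma ((-σ : ℝ) : ℂ))⁻¹ :=
    Complex.differentiable_one_div_Gamma.continuous.comp (by fun_prop)
  obtain ⟨B, hB⟩ := (isCompact_Icc (a := a) (b := b)).exists_bound_of_continuousOn
    hcont.continuousOn
  refine ⟨B, fun σ hσ => ?_⟩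
  have := hB σ hσ
  rwa [Complex.Gamma_ofReal, norm_inv, Complex.norm_real, Real.norm_eq_abs] at this

theorem exists_rieszKernel_bound (d : ℕ) :
    ∃ C R : ℝ, ∀ σ : ℝ, -(d : ℝ) / 2 < σ → σ < 1 → σ ≠ 0 → ∀ x : Fin d → ℤ, R ≤ latticeNorm x →
      |rieszKernel σ x - rieszConst d σ * latticeNorm x ^ (-(d : ℝ) - 2 * σ)|
        ≤ C * latticeNorm x ^ (-(d : ℝ) - 2 * σ - 2) := by
  obtain ⟨C, R, hC0, hR, hC⟩ := exists_integral_sub_bound d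
  obtain ⟨B, hB⟩ := exists_inv_Gamma_neg_bound (-(d : ℝ) / 2) 1
  refine ⟨B * C, R, fun σ hσ hσ1 hσ0 x hx => ?_⟩
  have hx0 : 0 < latticeNorm x := by linarith
  have hxne : x ≠ 0 := ne_zero_of_latticeNorm_pos hx0
  have h1 : rieszKernel σ x - rieszConst d σ * latticeNorm x ^ (-(d : ℝ) - 2 * σ)
      = |Real.Gamma (-σ)|⁻¹ * ((∫ t in Ioi (0 : ℝ), rieszIntegrand σ x t)
          - ∫ t in Ioi (0 : ℝ), gaussKernel t x * t ^ (-1 - σ)) := by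
    rw [rieszKernel, if_neg hσ0, if_neg fun h => hxne h.2, integral_gaussKernel hσ hx0, rieszConst,
      ← div_div]
    ring
  rw [h1, abs_mul, abs_of_nonneg (by positivity : 0 ≤ |Real.Gamma (-σ)|⁻¹), mul_assoc]
  exact mul_le_mul (hB σ ⟨hσ.le, hσ1.le⟩) (hC σ hσ hσ1 hσ0 x hx) (abs_nonneg _)
    ((by positivity : (0 : ℝ) ≤ |Real.Gamma (-σ)|⁻¹).trans (hB σ ⟨hσ.le, hσ1.le⟩))

end DiscreteRiesz

theorem theoremA1 (d : ℕ) (hd : 1 ≤ d) :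
    (∀ σ : ℝ, -(d : ℝ) / 2 < σ → σ < 1 → σ ≠ 0 → ∀ x : Fin d → ℤ, (0 < σ → x ≠ 0) →
      MeasureTheory.IntegrableOn (DiscreteRiesz.rieszIntegrand σ x) (Set.Ioi 0)) ∧
    ∃ C R : ℝ, ∀ σ : ℝ, -(d : ℝ) / 2 < σ → σ < 1 → σ ≠ 0 →
      ∀ x : Fin d → ℤ, R ≤ DiscreteRiesz.latticeNorm x →
        |DiscreteRiesz.rieszKernel σ x
            - DiscreteRiesz.rieszConst d σ * DiscreteRiesz.latticeNorm x ^ (-(d : ℝ) - 2 * σ)|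
          ≤ C * DiscreteRiesz.latticeNorm x ^ (-(d : ℝ) - 2 * σ - 2) :=
  ⟨fun _ hσ hσ1 hσ0 _ hx => DiscreteRiesz.integrableOn_rieszIntegrand hσ hσ1 hσ0 hx,
    DiscreteRiesz.exists_rieszKernel_bound d⟩
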